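/- Let $M$ be a connected conformal manifold of dimension $n\ge 2$: a connected Hausdorff topological space with a smooth ($C^\infty$) atlas modelled on $\mathbb R^n$ (no paracompactness or second countability is assumed), equipped with a conformal structure, i.e. a collection of smooth Riemannian metrics, each defined on an open subset of $M$, whose domains cover $M$ and any two of which are positive multiples of each other at every point of the intersection of their domains. For a compactly supported function $f:M\to\mathbb R$ which is Lipschitz (locally, in smooth charts) let $$I_M(f)=\int_M |\nabla f|^n\,dV\in[0,\infty],$$ where the gradient, its norm and the volume density are taken with respect to any of these local conformal metrics; the density $|\nabla f|^n\,dV$ does not depend on the choice. For a compact set $K\subset M$ let $Cap_M(K)$ be the infimum of $I_M(f)$ over all compactly supported Lipschitz functions $f$ on $M$ with $f=1$ on $K$. For $x,y\in M$ let $\mu_M(x,y)=\inf_C Cap_M(C)$, where $C$ runs over all continua (compact connected subsets) of $M$ that contain $x$ and $y$. Suppose that $M$ is of Class II, i.e. that $\mu_M(x,y)\ne 0$ for all $x\neq y$ in $M$. Then $\mu_M$ is a (finite) metric on $M$, and the topology induced by this metric is the manifold topology of $M$. -/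

import Mathlib

open Set Topology Manifold MeasureTheory
open scoped ContDiff ENNReal

namespace ConformalCapacity

/-- The model space `ℝⁿ` with its Euclidean norm and Lebesgue measure. -/
abbrev E (n : ℕ) : Type := EuclideanSpace ℝ (Fin n)

section

variable (n : ℕ) (M : Type*) [TopologicalSpace M] [ChartedSpace (E n) M]
  [IsManifold 𝓘(ℝ, E n) ∞ M]

/-- A smooth Riemannian metric defined on an open subset `dom` of `M`.
The values of `inner` outside `dom` play no role. -/
structure LocalMetric where
  dom : Set M
  isOpen_dom : IsOpen dom
  inner : ∀ x : M, TangentSpace 𝓘(ℝ, E n) x →L[ℝ] TangentSpace 𝓘(ℝ, E n) x →L[ℝ] ℝ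
  symm : ∀ x ∈ dom, ∀ v w : TangentSpace 𝓘(ℝ, E n) x, inner x v w = inner x w v
  pos : ∀ x ∈ dom, ∀ v : TangentSpace 𝓘(ℝ, E n) x, v ≠ 0 → 0 < inner x v v
  contMDiffOn : ContMDiffOn 𝓘(ℝ, E n) (𝓘(ℝ, E n).prod 𝓘(ℝ, E n →L[ℝ] E n →L[ℝ] ℝ)) ∞
    (fun x ↦ Bundle.TotalSpace.mk' (E n →L[ℝ] E n →L[ℝ] ℝ)
      (E := fun x : M ↦
        TangentSpace 𝓘(ℝ, E n) x →L[ℝ] TangentSpace 𝓘(ℝ, E n) x →L[ℝ] ℝ) x (inner x)) dom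

/-- A conformal structure on `M`: a collection of locally defined smooth Riemannian metrics,
whose domains cover `M`, and which are pairwise conformal on the overlaps of their domains. -/
structure ConformalStructure where
  localMetrics : Set (LocalMetric n M)
  cover : ∀ x : M, ∃ g ∈ localMetrics, x ∈ g.dom
  conformal : ∀ g ∈ localMetrics, ∀ h ∈ localMetrics, ∀ x ∈ g.dom ∩ h.dom,
    ∃ c : ℝ, 0 < c ∧ ∀ v w : TangentSpace 𝓘(ℝ, E n) x, h.inner x v w = c * g.inner x v w

end

noncomputable section

variable {n : ℕ} {M : Type*} [TopologicalSpace M] [ChartedSpace (E n) M]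
  [IsManifold 𝓘(ℝ, E n) ∞ M]

/-- The gradient of `f` at `x` with respect to `g`: the vector `∇f(x)` with
`g(∇f(x), w) = df(w)` for all `w` (see `LocalMetric.inner_gradient`). -/
def LocalMetric.gradient (g : LocalMetric n M) (f : M → ℝ) (x : M) :
    TangentSpace 𝓘(ℝ, E n) x :=
  (g.inner x).inverse (mfderiv 𝓘(ℝ, E n) 𝓘(ℝ, ℝ) f x : TangentSpace 𝓘(ℝ, E n) x →L[ℝ] ℝ)

theorem LocalMetric.inner_gradient (g : LocalMetric n M) (f : M → ℝ) {x : M} (hx : x ∈ g.dom)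
    (w : TangentSpace 𝓘(ℝ, E n) x) :
    g.inner x (g.gradient f x) w
      = (mfderiv 𝓘(ℝ, E n) 𝓘(ℝ, ℝ) f x : TangentSpace 𝓘(ℝ, E n) x →L[ℝ] ℝ) w := by
  have key : ∀ (B : E n →L[ℝ] E n →L[ℝ] ℝ) (_ : ∀ v, v ≠ 0 → 0 < B v v) (l : E n →L[ℝ] ℝ),
      B (B.inverse l) = l := by
    intro B hB l
    have hinj : Function.Injective B.toLinearMap := by
      rw [injective_iff_map_eq_zero]
      intro v hv
      by_contra hne
      have h1 := hB v hne
      have h2 : B v = 0 := hv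
      rw [h2] at h1
      simp at h1
    have hd : Module.finrank ℝ (E n) = Module.finrank ℝ (E n →L[ℝ] ℝ) := by
      rw [← (LinearMap.toContinuousLinearMap (𝕜 := ℝ) (E := E n) (F' := ℝ)).finrank_eq]
      exact (Subspace.dual_finrank_eq (K := ℝ) (V := E n)).symm
    let e : E n ≃L[ℝ] (E n →L[ℝ] ℝ) :=
      (LinearEquiv.ofInjectiveOfFinrankEq B.toLinearMap hinj hd).toContinuousLinearEquiv
    have he : B = (e : E n →L[ℝ] (E n →L[ℝ] ℝ)) := by
      ext v w
      rfl
    rw [he, ContinuousLinearMap.inverse_equiv]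
    simp
  exact congrArg (fun l : E n →L[ℝ] ℝ ↦ l w) (key (g.inner x) (g.pos x hx) _)

/-- The norm `|∇f(x)|` of the gradient with respect to `g`. -/
def LocalMetric.gradNorm (g : LocalMetric n M) (f : M → ℝ) (x : M) : ℝ :=
  Real.sqrt (g.inner x (g.gradient f x) (g.gradient f x))

/-- The coordinate vector field `∂/∂yᵢ` of the chart `φ`, at the point with coordinates `y`. -/
def coordVector (φ : OpenPartialHomeomorph M (E n)) (y : E n) (i : Fin n) :
    TangentSpace 𝓘(ℝ, E n) (φ.symm y) :=
  mfderiv 𝓘(ℝ, E n) 𝓘(ℝ, E n) φ.symm y (EuclideanSpace.single i (1 : ℝ) : E n)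

/-- The density `√det(gᵢⱼ)` of the Riemannian volume of `g` with respect to
Lebesgue measure in the chart `φ`, at the point with coordinates `y`. -/
def LocalMetric.volDensity (g : LocalMetric n M) (φ : OpenPartialHomeomorph M (E n)) (y : E n) :
    ℝ :=
  Real.sqrt (Matrix.det (Matrix.of fun i j : Fin n ↦
    g.inner (φ.symm y) (coordVector φ y i) (coordVector φ y j)))

/-- The `n`-energy `∫_A |∇f|ⁿ dV` of `f` over a subset `A` of the domain of the chart `φ`
and of the local metric `g`, computed in the coordinates `φ`. -/
def chartEnergy (g : LocalMetric n M) (φ : OpenPartialHomeomorph M (E n)) (A : Set M)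
    (f : M → ℝ) : ℝ≥0∞ :=
  ∫⁻ y in φ.target ∩ φ.symm ⁻¹' A,
    ENNReal.ofReal (g.gradNorm f (φ.symm y) ^ n * g.volDensity φ y)

/-- A Borel piece of `M` on which densities can be integrated in coordinates: a Borel set `carrier`
contained in the domain of a smooth chart and in the domain of a local conformal metric. -/
structure Piece (S : ConformalStructure n M) where
  chart : OpenPartialHomeomorph M (E n)
  chart_mem : chart ∈ IsManifold.maximalAtlas 𝓘(ℝ, E n) ∞ M
  metric : LocalMetric n M
  metric_mem : metric ∈ S.localMetrics
  carrier : Set M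
  measurable_carrier : MeasurableSet[borel M] carrier
  carrier_subset : carrier ⊆ chart.source ∩ metric.dom

/-- The `n`-energy integral `I_M(f) = ∫_M |∇f|ⁿ dV ∈ [0, ∞]`: the supremum, over finite families
of pairwise disjoint Borel pieces of `M`, of the sum of the energies of `f` over the pieces. -/
def energy (S : ConformalStructure n M) (f : M → ℝ) : ℝ≥0∞ :=
  ⨆ (k : ℕ) (P : Fin k → Piece S) (_ : Pairwise fun i j ↦ Disjoint (P i).carrier (P j).carrier),
    ∑ i, chartEnergy (P i).metric (P i).chart (P i).carrier f

variable (n) in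
/-- Lipschitz functions on a smooth manifold: Lipschitz, locally, in every smooth chart. -/
def IsLip (f : M → ℝ) : Prop :=
  ∀ φ ∈ IsManifold.maximalAtlas 𝓘(ℝ, E n) ∞ M, LocallyLipschitzOn φ.target (f ∘ φ.symm)

/-- The capacity `Cap_M(K)`: the infimum of `I_M(f)` over the compactly supported Lipschitz
functions `f` on `M` that equal `1` on `K`. -/
def capacity (S : ConformalStructure n M) (K : Set M) : ℝ≥0∞ :=
  ⨅ (f : M → ℝ) (_ : IsLip n f) (_ : HasCompactSupport f) (_ : ∀ x ∈ K, f x = 1), energy S f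

/-- `μ_M(x, y)`: the infimum of the capacities of the continua (compact connected subsets) of `M`
that contain `x` and `y`. -/
def mu (S : ConformalStructure n M) (x y : M) : ℝ≥0∞ :=
  ⨅ (C : Set M) (_ : IsCompact C) (_ : IsConnected C) (_ : x ∈ C) (_ : y ∈ C), capacity S C

/-- Class I: the pseudometric `μ_M` is not a metric, i.e. it vanishes at some pair of
distinct points. -/
def IsClassI (S : ConformalStructure n M) : Prop :=
  ∃ x y : M, x ≠ y ∧ mu S x y = 0

/-- Class II: not of Class I. -/
def IsClassII (S : ConformalStructure n M) : Prop :=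
  ¬ IsClassI S

end

end ConformalCapacity

/-! The exponent `n` equals the dimension, so rescaling the metric multiplies `|∇f|ⁿ` and the volume
density by inverse factors: the energy is conformally invariant and can be computed in any chart.

The triangle inequality comes from subadditivity of capacity. If `u` and `v` are admissible for `K`
and `L`, then `min (max u v) 1` is admissible for `K ∪ L`, with energy at most the sum
(`energy_max_le`, `energy_min_le`); two continua through a common point have a connected union.

The remaining analytic input is that small coordinate balls have small capacity
(`eventually_mu_le`). A cutoff that is linear in `log ‖z - p‖` between radii `r` and `R` has energy
at most a constant times `(log (R / r)) ^ (1 - n)`, which tends to `0` as `r → 0` because `n ≥ 2`.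
Hence `μ` vanishes on the diagonal, is finite by connectedness, and is continuous for the manifold
topology. Definiteness is the Class II hypothesis.

Conversely, a continuum from `x` to a point outside a coordinate ball meets the bounding sphere,
which is compact, so that `μ x` has a positive lower bound on it. The same bound then holds outside
the ball (`exists_mu_lt_imp_mem`), and the two topologies agree. Test functions live in a single
chart, so no partition of unity is needed. -/

namespace ConformalCapacity

noncomputable section

section

/-! ### Linear algebra behind conformal invariance -/

section BilinearForms

variable {n : ℕ}

/-- The Gram determinant of `B` in the standard basis. -/
def stdDet (B : E n →L[ℝ] E n →L[ℝ] ℝ) : ℝ :=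
  Matrix.det (Matrix.of fun i j : Fin n ↦
    B (EuclideanSpace.single i (1 : ℝ)) (EuclideanSpace.single j (1 : ℝ)))

theorem gram_det_comp (B : E n →L[ℝ] E n →L[ℝ] ℝ) (D : E n →L[ℝ] E n) :
    Matrix.det (Matrix.of fun i j : Fin n ↦
      B (D (EuclideanSpace.single i (1 : ℝ))) (D (EuclideanSpace.single j (1 : ℝ))))
      = D.det ^ 2 * stdDet B := by
  let b := (EuclideanSpace.basisFun (Fin n) ℝ).toBasis
  have hb : ∀ i, b i = EuclideanSpace.single i (1 : ℝ) := fun i ↦ by simp [b]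
  have hD : D.det = (LinearMap.toMatrix b b D.toLinearMap).det := by
    rw [LinearMap.det_toMatrix]
  have hexp : ∀ i, D (b i) = ∑ k, LinearMap.toMatrix b b D.toLinearMap k i • b k := by
    intro i
    conv_lhs => rw [← b.sum_repr (D (b i))]
    simp only [LinearMap.toMatrix_apply]
    rfl
  have hmat : (Matrix.of fun i j : Fin n ↦ B (D (b i)) (D (b j)))
      = (LinearMap.toMatrix b b D.toLinearMap).transpose *
        (Matrix.of fun i j : Fin n ↦ B (b i) (b j)) * LinearMap.toMatrix b b D.toLinearMap := by
    ext i j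
    simp only [Matrix.of_apply, Matrix.mul_apply, Matrix.transpose_apply]
    rw [hexp i, hexp j]
    simp only [map_sum, map_smul, sum_apply, smul_apply,
      smul_eq_mul, Finset.sum_mul]
    refine Finset.sum_congr rfl fun k _ ↦ ?_
    rw [Finset.mul_sum]
    refine Finset.sum_congr rfl fun l _ ↦ ?_
    ring
  simp only [hb] at hmat
  rw [hmat, Matrix.det_mul, Matrix.det_mul, Matrix.det_transpose, hD, stdDet]
  ring

theorem stdDet_smul (B : E n →L[ℝ] E n →L[ℝ] ℝ) (c : ℝ) : stdDet (c • B) = c ^ n * stdDet B := by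
  have : (Matrix.of fun i j : Fin n ↦
      (c • B) (EuclideanSpace.single i (1 : ℝ)) (EuclideanSpace.single j (1 : ℝ)))
      = c • Matrix.of fun i j : Fin n ↦
      B (EuclideanSpace.single i (1 : ℝ)) (EuclideanSpace.single j (1 : ℝ)) := by
    ext i j; simp
  rw [stdDet, this, Matrix.det_smul, stdDet, Fintype.card_fin]

/-- `ContinuousLinearMap.inverse` is `0` on non-invertible maps; positivity gives injectivity, and
equality of dimensions makes `B` invertible. -/
theorem apply_inverse_of_pos (B : E n →L[ℝ] E n →L[ℝ] ℝ) (hB : ∀ v, v ≠ 0 → 0 < B v v)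
    (l : E n →L[ℝ] ℝ) : B (B.inverse l) = l ∧ B.IsInvertible := by
  have hinj : Function.Injective B.toLinearMap := by
    rw [injective_iff_map_eq_zero]
    intro v hv
    by_contra hne
    have h1 := hB v hne
    have h2 : B v = 0 := hv
    simp [h2] at h1
  have hd : Module.finrank ℝ (E n) = Module.finrank ℝ (E n →L[ℝ] ℝ) := by
    rw [← (LinearMap.toContinuousLinearMap (𝕜 := ℝ) (E := E n) (F' := ℝ)).finrank_eq]
    exact (Subspace.dual_finrank_eq (K := ℝ) (V := E n)).symm
  let e : E n ≃L[ℝ] (E n →L[ℝ] ℝ) :=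
    (LinearEquiv.ofInjectiveOfFinrankEq B.toLinearMap hinj hd).toContinuousLinearEquiv
  have he : B = (e : E n →L[ℝ] (E n →L[ℝ] ℝ)) := by
    ext v w
    rfl
  rw [he, ContinuousLinearMap.inverse_equiv]
  exact ⟨by simp, e, rfl⟩

/-- The pointwise energy density of a covector `l` for the inner product `B`. -/
def covDensity (B : E n →L[ℝ] E n →L[ℝ] ℝ) (l : E n →L[ℝ] ℝ) : ℝ :=
  Real.sqrt (B (B.inverse l) (B.inverse l)) ^ n * Real.sqrt (stdDet B)

/-- The squared gradient norm scales by `c⁻¹` and the Gram determinant by `c ^ n`; after taking the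
`n`-th power of the norm the factors `√c ^ n` cancel. -/
theorem covDensity_smul (B : E n →L[ℝ] E n →L[ℝ] ℝ) (hB : ∀ v, v ≠ 0 → 0 < B v v) {c : ℝ}
    (hc : 0 < c) (l : E n →L[ℝ] ℝ) : covDensity (c • B) l = covDensity B l := by
  have hcB : ∀ v, v ≠ 0 → 0 < (c • B) v v := fun v hv ↦ by
    simpa using mul_pos hc (hB v hv)
  have hinv : (c • B).inverse l = c⁻¹ • B.inverse l := by
    have h1 := (apply_inverse_of_pos _ hcB l).1
    have h2 := (apply_inverse_of_pos _ hB l).1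
    have hinj : Function.Injective (c • B) := by
      obtain ⟨e, he⟩ := (apply_inverse_of_pos _ hcB l).2
      rw [← he]; exact e.injective
    apply hinj
    rw [h1, map_smul, smul_apply, smul_smul, inv_mul_cancel₀ hc.ne', one_smul,
      h2]
  rw [covDensity, covDensity, hinv, stdDet_smul]
  set v := B.inverse l
  have h1 : (c • B) (c⁻¹ • v) (c⁻¹ • v) = c⁻¹ * B v v := by
    simp only [smul_apply, map_smul, smul_eq_mul]
    field_simp
  rw [h1, Real.sqrt_mul (inv_nonneg.2 hc.le), Real.sqrt_mul (pow_nonneg hc.le n), mul_pow]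
  have h2 : Real.sqrt (c ^ n) = Real.sqrt c ^ n := by
    rw [Real.sqrt_eq_iff_mul_self_eq (by positivity) (by positivity), ← mul_pow,
      Real.mul_self_sqrt hc.le]
  have h3 : Real.sqrt c ≠ 0 := (Real.sqrt_pos.2 hc).ne'
  rw [h2, Real.sqrt_inv, inv_pow]
  field_simp

end BilinearForms

/-! ### Chart independence of the energy -/

variable {n : ℕ} {M : Type*} [TopologicalSpace M] [ChartedSpace (E n) M]
  [IsManifold 𝓘(ℝ, E n) ∞ M]

/-- The derivative of the inverse of a chart, as an endomorphism of the model space. -/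
def symmDeriv (φ : OpenPartialHomeomorph M (E n)) (y : E n) : E n →L[ℝ] E n :=
  mfderiv 𝓘(ℝ, E n) 𝓘(ℝ, E n) φ.symm y

/-- The differential of a function, as a linear form on the model space. -/
def differential (f : M → ℝ) (x : M) : E n →L[ℝ] ℝ :=
  mfderiv 𝓘(ℝ, E n) 𝓘(ℝ, ℝ) f x

/-- A local metric at a point, as a bilinear form on the model space. -/
def LocalMetric.form (g : LocalMetric n M) (x : M) : E n →L[ℝ] E n →L[ℝ] ℝ := g.inner x

theorem LocalMetric.form_pos (g : LocalMetric n M) {x : M} (hx : x ∈ g.dom) (v : E n)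
    (hv : v ≠ 0) : 0 < g.form x v v := g.pos x hx v hv

theorem LocalMetric.gradNorm_eq (g : LocalMetric n M) (f : M → ℝ) (x : M) :
    g.gradNorm f x = Real.sqrt (g.form x ((g.form x).inverse (differential f x))
      ((g.form x).inverse (differential f x))) := rfl

theorem LocalMetric.volDensity_eq (g : LocalMetric n M) (φ : OpenPartialHomeomorph M (E n))
    (y : E n) : g.volDensity φ y = |(symmDeriv φ y).det| * Real.sqrt (stdDet (g.form (φ.symm y))) := by
  have := gram_det_comp (g.form (φ.symm y)) (symmDeriv φ y)
  rw [← Real.sqrt_sq_eq_abs, ← Real.sqrt_mul (sq_nonneg _), ← this]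
  rfl

/-- Separates a Jacobian, which depends only on the chart, from a density that depends only on the
point and the conformal class. -/
theorem LocalMetric.integrand_eq (g : LocalMetric n M) (φ : OpenPartialHomeomorph M (E n))
    (f : M → ℝ) (y : E n) :
    g.gradNorm f (φ.symm y) ^ n * g.volDensity φ y =
      |(symmDeriv φ y).det| * covDensity (g.form (φ.symm y)) (differential f (φ.symm y)) := by
  rw [g.volDensity_eq, g.gradNorm_eq, covDensity]
  ring

theorem ConformalStructure.covDensity_eq (S : ConformalStructure n M) {g h : LocalMetric n M}
    (hg : g ∈ S.localMetrics) (hh : h ∈ S.localMetrics) {x : M} (hx : x ∈ g.dom ∩ h.dom)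
    (l : E n →L[ℝ] ℝ) : covDensity (h.form x) l = covDensity (g.form x) l := by
  obtain ⟨c, hc, hcg⟩ := S.conformal g hg h hh x hx
  have : h.form x = c • g.form x := by
    ext v w
    exact hcg v w
  rw [this, covDensity_smul _ (g.form_pos hx.1) hc]

omit [IsManifold 𝓘(ℝ, E n) ∞ M] in
theorem mdifferentiable_of_mem_maximalAtlas {φ : OpenPartialHomeomorph M (E n)}
    (hφ : φ ∈ IsManifold.maximalAtlas 𝓘(ℝ, E n) ∞ M) :
    φ.MDifferentiable 𝓘(ℝ, E n) 𝓘(ℝ, E n) :=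
  ⟨(contMDiffOn_of_mem_maximalAtlas hφ).mdifferentiableOn (by simp),
    (contMDiffOn_symm_of_mem_maximalAtlas hφ).mdifferentiableOn (by simp)⟩

omit [IsManifold 𝓘(ℝ, E n) ∞ M] in
theorem contDiffOn_transition {φ ψ : OpenPartialHomeomorph M (E n)}
    (hφ : φ ∈ IsManifold.maximalAtlas 𝓘(ℝ, E n) ∞ M)
    (hψ : ψ ∈ IsManifold.maximalAtlas 𝓘(ℝ, E n) ∞ M) :
    ContDiffOn ℝ ∞ (ψ ∘ φ.symm) (φ.target ∩ φ.symm ⁻¹' ψ.source) := by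
  rw [← contMDiffOn_iff_contDiffOn]
  exact (contMDiffOn_of_mem_maximalAtlas hψ).comp
    ((contMDiffOn_symm_of_mem_maximalAtlas hφ).mono inter_subset_left) fun y hy ↦ hy.2

omit [IsManifold 𝓘(ℝ, E n) ∞ M] in
theorem symmDeriv_transition {φ ψ : OpenPartialHomeomorph M (E n)}
    (hφ : φ ∈ IsManifold.maximalAtlas 𝓘(ℝ, E n) ∞ M)
    (hψ : ψ ∈ IsManifold.maximalAtlas 𝓘(ℝ, E n) ∞ M) {y : E n}
    (hy : y ∈ φ.target ∩ φ.symm ⁻¹' ψ.source) :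
    symmDeriv φ y = (symmDeriv ψ (ψ (φ.symm y))).comp (fderiv ℝ (ψ ∘ φ.symm) y) := by
  have hopen : IsOpen (φ.target ∩ φ.symm ⁻¹' ψ.source) :=
    φ.symm.isOpen_inter_preimage ψ.open_source
  have hT : MDifferentiableAt 𝓘(ℝ, E n) 𝓘(ℝ, E n) (ψ ∘ φ.symm) y :=
    (((contDiffOn_transition hφ hψ).differentiableOn (by simp)).differentiableAt
      (hopen.mem_nhds hy)).mdifferentiableAt
  have hS : MDifferentiableAt 𝓘(ℝ, E n) 𝓘(ℝ, E n) ψ.symm ((ψ ∘ φ.symm) y) :=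
    (mdifferentiable_of_mem_maximalAtlas hψ).mdifferentiableAt_symm (ψ.map_source hy.2)
  have hev : φ.symm =ᶠ[𝓝 y] ψ.symm ∘ (ψ ∘ φ.symm) := by
    filter_upwards [hopen.mem_nhds hy] with z hz
    exact (ψ.left_inv hz.2).symm
  have h1 : mfderiv 𝓘(ℝ, E n) 𝓘(ℝ, E n) (ψ.symm ∘ (ψ ∘ φ.symm)) y = _ := mfderiv_comp y hS hT
  have h2 := hev.mfderiv_eq (I := 𝓘(ℝ, E n)) (I' := 𝓘(ℝ, E n))
  rw [mfderiv_eq_fderiv] at h1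
  exact h2.trans h1

omit [ChartedSpace (E n) M] [IsManifold 𝓘(ℝ, E n) ∞ M] in
theorem measurableSet_target_inter (φ : OpenPartialHomeomorph M (E n)) {A : Set M}
    (hA : MeasurableSet[borel M] A) : MeasurableSet (φ.target ∩ φ.symm ⁻¹' A) := by
  borelize M
  have hc : Continuous fun y : φ.target ↦ φ.symm y :=
    continuousOn_iff_continuous_domRestrict.1 φ.continuousOn_symm
  have h : MeasurableSet (Subtype.val '' ((fun y : φ.target ↦ φ.symm y) ⁻¹' A)) :=
    φ.open_target.measurableSet.subtype_image (hc.measurable hA)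
  convert h using 1
  ext y
  simp [and_comm]

theorem chartEnergy_eq_covDensity (g : LocalMetric n M) (φ : OpenPartialHomeomorph M (E n))
    (A : Set M) (f : M → ℝ) : chartEnergy g φ A f = ∫⁻ y in φ.target ∩ φ.symm ⁻¹' A,
      ENNReal.ofReal (|(symmDeriv φ y).det| *
        covDensity (g.form (φ.symm y)) (differential f (φ.symm y))) := by
  simp only [chartEnergy, g.integrand_eq]

/-- The energy of a piece does not depend on the chart and the conformal metric. -/
theorem chartEnergy_eq (S : ConformalStructure n M) {g h : LocalMetric n M}
    (hg : g ∈ S.localMetrics) (hh : h ∈ S.localMetrics) {φ ψ : OpenPartialHomeomorph M (E n)}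
    (hφ : φ ∈ IsManifold.maximalAtlas 𝓘(ℝ, E n) ∞ M)
    (hψ : ψ ∈ IsManifold.maximalAtlas 𝓘(ℝ, E n) ∞ M) {A : Set M}
    (hA : MeasurableSet[borel M] A) (hAφ : A ⊆ φ.source ∩ g.dom) (hAψ : A ⊆ ψ.source ∩ h.dom)
    (f : M → ℝ) : chartEnergy g φ A f = chartEnergy h ψ A f := by
  have hs := measurableSet_target_inter φ hA
  have hsub : φ.target ∩ φ.symm ⁻¹' A ⊆ φ.target ∩ φ.symm ⁻¹' ψ.source :=
    fun y hy ↦ ⟨hy.1, (hAψ hy.2).1⟩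
  have hopen : IsOpen (φ.target ∩ φ.symm ⁻¹' ψ.source) :=
    φ.symm.isOpen_inter_preimage ψ.open_source
  have himage : (ψ ∘ φ.symm) '' (φ.target ∩ φ.symm ⁻¹' A) = ψ.target ∩ ψ.symm ⁻¹' A := by
    ext z
    constructor
    · rintro ⟨y, hy, rfl⟩
      refine ⟨ψ.map_source (hsub hy).2, ?_⟩
      simpa [ψ.left_inv (hsub hy).2] using hy.2
    · rintro ⟨hz, hzA⟩
      refine ⟨φ (ψ.symm z), ⟨φ.map_source (hAφ hzA).1, ?_⟩, ?_⟩
      · simpa [φ.left_inv (hAφ hzA).1] using hzA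
      · simp [φ.left_inv (hAφ hzA).1, ψ.right_inv hz]
  have hinj : InjOn (ψ ∘ φ.symm) (φ.target ∩ φ.symm ⁻¹' A) :=
    fun y hy z hz hyz ↦ φ.symm.injOn hy.1 hz.1 (ψ.injOn (hsub hy).2 (hsub hz).2 hyz)
  have hderiv : ∀ y ∈ φ.target ∩ φ.symm ⁻¹' A,
      HasFDerivWithinAt (ψ ∘ φ.symm) (fderiv ℝ (ψ ∘ φ.symm) y) (φ.target ∩ φ.symm ⁻¹' A) y :=
    fun y hy ↦ (((contDiffOn_transition hφ hψ).differentiableOn (by simp)).differentiableAt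
      (hopen.mem_nhds (hsub hy))).hasFDerivAt.hasFDerivWithinAt
  -- Change of variables along the transition map; its Jacobian is absorbed by the chain rule for
  -- `symmDeriv`.
  rw [chartEnergy_eq_covDensity, chartEnergy_eq_covDensity, ← himage,
    lintegral_image_eq_lintegral_abs_det_fderiv_mul volume hs hderiv hinj]
  refine setLIntegral_congr_fun hs fun y hy ↦ ?_
  have hx : φ.symm y ∈ g.dom ∩ h.dom := ⟨(hAφ hy.2).2, (hAψ hy.2).2⟩
  have hinv : ψ.symm ((ψ ∘ φ.symm) y) = φ.symm y := ψ.left_inv (hsub hy).2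
  have hdet : (symmDeriv φ y).det
      = (symmDeriv ψ ((ψ ∘ φ.symm) y)).det * (fderiv ℝ (ψ ∘ φ.symm) y).det := by
    rw [symmDeriv_transition hφ hψ (hsub hy)]
    exact LinearMap.det_comp _ _
  simp only [hinv]
  rw [← ENNReal.ofReal_mul (abs_nonneg _), S.covDensity_eq hg hh hx, hdet, abs_mul]
  congr 1
  ring

section Differential

variable {φ : OpenPartialHomeomorph M (E n)}

omit [ChartedSpace (E n) M] [IsManifold 𝓘(ℝ, E n) ∞ M] in
theorem eventuallyEq_comp_symm_comp (f : M → ℝ) {y : E n} (hy : y ∈ φ.target) :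
    f =ᶠ[𝓝 (φ.symm y)] (f ∘ φ.symm) ∘ φ := by
  filter_upwards [φ.open_source.mem_nhds (φ.map_target hy)] with x hx
  simp [φ.left_inv hx]

omit [IsManifold 𝓘(ℝ, E n) ∞ M] in
theorem mdifferentiableAt_symm_iff (hφ : φ ∈ IsManifold.maximalAtlas 𝓘(ℝ, E n) ∞ M) (f : M → ℝ)
    {y : E n} (hy : y ∈ φ.target) :
    MDifferentiableAt 𝓘(ℝ, E n) 𝓘(ℝ, ℝ) f (φ.symm y) ↔ DifferentiableAt ℝ (f ∘ φ.symm) y := by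
  have hd := mdifferentiable_of_mem_maximalAtlas hφ
  constructor
  · intro h
    exact (h.comp y (hd.mdifferentiableAt_symm hy)).differentiableAt
  · intro h
    have h1 : MDifferentiableAt 𝓘(ℝ, E n) 𝓘(ℝ, ℝ) (f ∘ φ.symm) (φ (φ.symm y)) := by
      rw [φ.right_inv hy]; exact h.mdifferentiableAt
    exact (h1.comp _ (hd.mdifferentiableAt (φ.map_target hy))).congr_of_eventuallyEq
      (eventuallyEq_comp_symm_comp f hy)

omit [IsManifold 𝓘(ℝ, E n) ∞ M] in
-- No differentiability is assumed: `f` and `f ∘ φ.symm` are differentiable at corresponding points,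
-- and otherwise both derivatives take the default value `0`.
theorem fderiv_comp_symm (hφ : φ ∈ IsManifold.maximalAtlas 𝓘(ℝ, E n) ∞ M) (f : M → ℝ)
    {y : E n} (hy : y ∈ φ.target) :
    fderiv ℝ (f ∘ φ.symm) y = (differential f (φ.symm y)).comp (symmDeriv φ y) := by
  have hd := mdifferentiable_of_mem_maximalAtlas hφ
  by_cases h : MDifferentiableAt 𝓘(ℝ, E n) 𝓘(ℝ, ℝ) f (φ.symm y)
  · rw [← mfderiv_eq_fderiv]
    exact mfderiv_comp y h (hd.mdifferentiableAt_symm hy)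
  · rw [fderiv_zero_of_not_differentiableAt (mt (mdifferentiableAt_symm_iff hφ f hy).2 h)]
    have : (differential f (φ.symm y) : E n →L[ℝ] ℝ) = 0 := mfderiv_zero_of_not_mdifferentiableAt h
    rw [this]; simp

omit [IsManifold 𝓘(ℝ, E n) ∞ M] in
theorem symmDeriv_bijective (hφ : φ ∈ IsManifold.maximalAtlas 𝓘(ℝ, E n) ∞ M)
    {y : E n} (hy : y ∈ φ.target) : Function.Bijective (symmDeriv φ y) :=
  (mdifferentiable_of_mem_maximalAtlas hφ).symm.mfderiv_bijective hy

omit [IsManifold 𝓘(ℝ, E n) ∞ M] in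
theorem differential_eq_of_fderiv_eq (hφ : φ ∈ IsManifold.maximalAtlas 𝓘(ℝ, E n) ∞ M)
    {u v : M → ℝ} {y : E n} (hy : y ∈ φ.target)
    (h : fderiv ℝ (u ∘ φ.symm) y = fderiv ℝ (v ∘ φ.symm) y) :
    (differential u (φ.symm y) : E n →L[ℝ] ℝ) = differential v (φ.symm y) := by
  rw [fderiv_comp_symm hφ u hy, fderiv_comp_symm hφ v hy] at h
  ext w
  obtain ⟨w, rfl⟩ := (symmDeriv_bijective hφ hy).2 w
  exact congrArg (fun l : E n →L[ℝ] ℝ ↦ l w) h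

end Differential

end

/-! ### Lattice operations, subadditivity of capacity, triangle inequality -/

section

/-- Rademacher's theorem, localized: a set that is null near each of its points is null. -/
theorem ae_differentiableAt_of_locallyLipschitzOn {n : ℕ} {f : E n → ℝ} {s : Set (E n)}
    (hs : IsOpen s) (hf : LocallyLipschitzOn s f) : ∀ᵐ y, y ∈ s → DifferentiableAt ℝ f y := by
  rw [ae_iff]
  refine measure_null_of_locally_null _ fun x hx ↦ ?_
  simp only [Classical.not_imp, mem_ofPred_eq] at hx
  obtain ⟨K, t, ht, hK⟩ := hf hx.1
  rw [hs.nhdsWithin_eq hx.1] at ht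
  obtain ⟨u, hut, hu, hxu⟩ := mem_nhds_iff.1 ht
  refine ⟨_, inter_mem_nhdsWithin _ (hu.mem_nhds hxu), ?_⟩
  have h := (hK.mono hut).ae_differentiableWithinAt_of_mem (μ := volume)
  rw [ae_iff] at h
  refine measure_mono_null ?_ h
  rintro y ⟨hy, hyu⟩
  simp only [Classical.not_imp, mem_ofPred_eq] at hy ⊢
  exact ⟨hyu, fun hd ↦ hy.2 (hd.differentiableAt (hu.mem_nhds hyu))⟩

variable {n : ℕ} {M : Type*} [TopologicalSpace M] [ChartedSpace (E n) M]
  [IsManifold 𝓘(ℝ, E n) ∞ M]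

/-- The global inequality `u ≤ v` makes every point of `A` a minimum of `v - u`, so the
differentials agree wherever both exist, hence almost everywhere on `A`. This avoids density points
of `A`. -/
theorem chartEnergy_congr_of_le {S : ConformalStructure n M} (P : Piece S) {u v : M → ℝ}
    (hu : IsLip n u) (hv : IsLip n v) (huv : ∀ x, u x ≤ v x) {A : Set M}
    (hA : MeasurableSet[borel M] A) (heq : EqOn u v A) :
    chartEnergy P.metric P.chart A u = chartEnergy P.metric P.chart A v := by
  set φ := P.chart
  rw [chartEnergy_eq_covDensity, chartEnergy_eq_covDensity]
  refine setLIntegral_congr_fun_ae (measurableSet_target_inter φ hA) ?_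
  filter_upwards [ae_differentiableAt_of_locallyLipschitzOn φ.open_target (hu φ P.chart_mem),
    ae_differentiableAt_of_locallyLipschitzOn φ.open_target (hv φ P.chart_mem)] with y h1 h2 hy
  have h1 := h1 hy.1
  have h2 := h2 hy.1
  have hmin : IsLocalMin (v ∘ φ.symm - u ∘ φ.symm) y := by
    refine Filter.Eventually.of_forall fun z ↦ ?_
    have := huv (φ.symm z)
    have h3 := heq hy.2
    simp [h3, this]
  have h0 := hmin.fderiv_eq_zero
  rw [fderiv_sub h2 h1, sub_eq_zero] at h0
  rw [differential_eq_of_fderiv_eq P.chart_mem hy.1 h0]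

theorem chartEnergy_union {g : LocalMetric n M} {φ : OpenPartialHomeomorph M (E n)}
    {A B : Set M} (hB : MeasurableSet[borel M] B) (hAB : Disjoint A B) (f : M → ℝ) :
    chartEnergy g φ (A ∪ B) f = chartEnergy g φ A f + chartEnergy g φ B f := by
  rw [chartEnergy, preimage_union, inter_union_distrib_left, lintegral_union
    (measurableSet_target_inter φ hB)]
  · rfl
  · exact ((hAB.preimage _).mono inter_subset_right inter_subset_right)

/-- The energy vanishes where the differential does. -/
theorem chartEnergy_eq_zero (hn : n ≠ 0) {g : LocalMetric n M} {φ : OpenPartialHomeomorph M (E n)}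
    {A : Set M} (hA : MeasurableSet[borel M] A) {f : M → ℝ}
    (hf : ∀ x ∈ A, (differential f x : E n →L[ℝ] ℝ) = 0) : chartEnergy g φ A f = 0 := by
  rw [chartEnergy_eq_covDensity]
  refine (setLIntegral_congr_fun (measurableSet_target_inter φ hA) fun y hy ↦ ?_).trans
    lintegral_zero
  have h := hf _ hy.2
  simp [h, covDensity, zero_pow hn]

/-- The part of a piece that lies in a given Borel set. -/
def Piece.inter {S : ConformalStructure n M} (P : Piece S) (A : Set M)
    (hA : MeasurableSet[borel M] A) : Piece S where
  __ := P
  carrier := P.carrier ∩ A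
  measurable_carrier := by
    borelize M
    exact MeasurableSet.inter P.measurable_carrier hA
  carrier_subset := inter_subset_left.trans P.carrier_subset

theorem sum_chartEnergy_le_energy {S : ConformalStructure n M} (f : M → ℝ) {k : ℕ}
    (P : Fin k → Piece S) (hP : Pairwise fun i j ↦ Disjoint (P i).carrier (P j).carrier) :
    ∑ i, chartEnergy (P i).metric (P i).chart (P i).carrier f ≤ energy S f :=
  le_iSup_of_le k (le_iSup_of_le P (le_iSup_of_le hP le_rfl))

/-- Splitting the pieces along a Borel set `A`: the energy of a function that agrees with `u` on
`A` and with `v` off `A`, one-sidedly. -/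
theorem energy_le_add {S : ConformalStructure n M} {f u v : M → ℝ} (A : Set M)
    (hA : MeasurableSet[borel M] A)
    (hu : ∀ P : Piece S, ∀ B, MeasurableSet[borel M] B → B ⊆ A →
      chartEnergy P.metric P.chart B f ≤ chartEnergy P.metric P.chart B u)
    (hv : ∀ P : Piece S, ∀ B, MeasurableSet[borel M] B → B ⊆ Aᶜ →
      chartEnergy P.metric P.chart B f ≤ chartEnergy P.metric P.chart B v) :
    energy S f ≤ energy S u + energy S v := by
  have hA' : MeasurableSet[borel M] Aᶜ := by
    borelize M
    exact MeasurableSet.compl hA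
  refine iSup_le fun k ↦ iSup_le fun P ↦ iSup_le fun hP ↦ ?_
  have hsplit : ∀ i, chartEnergy (P i).metric (P i).chart (P i).carrier f ≤
      chartEnergy (P i).metric (P i).chart ((P i).inter A hA).carrier u +
      chartEnergy (P i).metric (P i).chart ((P i).inter Aᶜ hA').carrier v := by
    intro i
    have h : (P i).carrier = ((P i).inter A hA).carrier ∪ ((P i).inter Aᶜ hA').carrier :=
      (inter_union_compl _ _).symm
    conv_lhs => rw [h]
    have hd : Disjoint ((P i).inter A hA).carrier ((P i).inter Aᶜ hA').carrier :=
      disjoint_compl_right.mono inter_subset_right inter_subset_right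
    rw [chartEnergy_union ((P i).inter Aᶜ hA').measurable_carrier hd]
    exact add_le_add (hu _ _ ((P i).inter A hA).measurable_carrier inter_subset_right)
      (hv _ _ ((P i).inter Aᶜ hA').measurable_carrier inter_subset_right)
  refine (Finset.sum_le_sum fun i _ ↦ hsplit i).trans ?_
  rw [Finset.sum_add_distrib]
  exact add_le_add
    (sum_chartEnergy_le_energy u (fun i ↦ (P i).inter A hA)
      fun i j hij ↦ (hP hij).mono inter_subset_left inter_subset_left)
    (sum_chartEnergy_le_energy v (fun i ↦ (P i).inter Aᶜ hA')
      fun i j hij ↦ (hP hij).mono inter_subset_left inter_subset_left)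

theorem energy_const (hn : n ≠ 0) (S : ConformalStructure n M) (c : ℝ) :
    energy S (fun _ : M ↦ c) = 0 := by
  simp only [energy, ENNReal.iSup_eq_zero, Finset.sum_eq_zero_iff]
  intro k P _ i _
  refine chartEnergy_eq_zero hn (P i).measurable_carrier fun x _ ↦ ?_
  exact mfderiv_const

omit [IsManifold 𝓘(ℝ, E n) ∞ M] in
theorem isLip_const (c : ℝ) : IsLip n (fun _ : M ↦ c) :=
  fun φ _ ↦ (LocallyLipschitz.const (α := E n) c).locallyLipschitzOn (s := φ.target)

omit [IsManifold 𝓘(ℝ, E n) ∞ M] in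
theorem IsLip.max {u v : M → ℝ} (hu : IsLip n u) (hv : IsLip n v) :
    IsLip n fun x ↦ max (u x) (v x) := by
  intro φ hφ y hy
  obtain ⟨K, s, hs, hK⟩ := hu φ hφ hy
  obtain ⟨L, t, ht, hL⟩ := hv φ hφ hy
  exact ⟨_, s ∩ t, Filter.inter_mem hs ht,
    lipschitzWith_max.comp_lipschitzOnWith ((hK.mono inter_subset_left).prodMk
      (hL.mono inter_subset_right))⟩

omit [IsManifold 𝓘(ℝ, E n) ∞ M] in
theorem IsLip.min {u v : M → ℝ} (hu : IsLip n u) (hv : IsLip n v) :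
    IsLip n fun x ↦ min (u x) (v x) := by
  intro φ hφ y hy
  obtain ⟨K, s, hs, hK⟩ := hu φ hφ hy
  obtain ⟨L, t, ht, hL⟩ := hv φ hφ hy
  exact ⟨_, s ∩ t, Filter.inter_mem hs ht,
    lipschitzWith_min.comp_lipschitzOnWith ((hK.mono inter_subset_left).prodMk
      (hL.mono inter_subset_right))⟩

omit [IsManifold 𝓘(ℝ, E n) ∞ M] in
theorem IsLip.continuous {u : M → ℝ} [IsManifold 𝓘(ℝ, E n) ∞ M] (hu : IsLip n u) :
    Continuous u := by
  refine continuous_iff_continuousAt.2 fun x ↦ ?_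
  have hφ := IsManifold.chart_mem_maximalAtlas (I := 𝓘(ℝ, E n)) (n := ∞) x
  have hx := mem_chart_target (E n) x
  have h1 : ContinuousAt (u ∘ (chartAt (E n) x).symm) (chartAt (E n) x x) :=
    (hu _ hφ).continuousOn.continuousAt ((chartAt (E n) x).open_target.mem_nhds hx)
  have h2 := h1.comp ((chartAt (E n) x).continuousAt (mem_chart_source (E n) x))
  refine h2.congr ?_
  filter_upwards [(chartAt (E n) x).open_source.mem_nhds (mem_chart_source (E n) x)] with z hz
  simp [(chartAt (E n) x).left_inv hz]

/-- The maximum dominates both functions everywhere and equals one of them on each side of the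
splitting set `{v ≤ u}`. -/
theorem energy_max_le {S : ConformalStructure n M} {u v : M → ℝ} (hu : IsLip n u)
    (hv : IsLip n v) : energy S (fun x ↦ max (u x) (v x)) ≤ energy S u + energy S v := by
  have hA : MeasurableSet[borel M] {x | v x ≤ u x} := by
    borelize M
    exact (isClosed_le hv.continuous hu.continuous).measurableSet
  refine energy_le_add {x | v x ≤ u x} hA (fun P B hB hBA ↦ ?_) fun P B hB hBA ↦ ?_
  · exact (chartEnergy_congr_of_le P hu (hu.max hv) (fun x ↦ le_max_left _ _) hB
      fun x hx ↦ (max_eq_left (hBA hx)).symm).ge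
  · exact (chartEnergy_congr_of_le P hv (hu.max hv) (fun x ↦ le_max_right _ _) hB
      fun x hx ↦ (max_eq_right (by simpa using hBA hx : _ < _).le).symm).ge

theorem energy_min_le (hn : n ≠ 0) {S : ConformalStructure n M} {u : M → ℝ} (hu : IsLip n u)
    (c : ℝ) : energy S (fun x ↦ min (u x) c) ≤ energy S u := by
  have hc : IsLip n (fun _ : M ↦ c) := isLip_const c
  have hA : MeasurableSet[borel M] {x | u x ≤ c} := by
    borelize M
    exact (isClosed_le hu.continuous continuous_const).measurableSet
  have h := energy_le_add (S := S) (f := fun x ↦ min (u x) c) (u := u) (v := fun _ ↦ c)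
    {x | u x ≤ c} hA (fun P B hB hBA ↦ ?_) fun P B hB hBA ↦ ?_
  · simpa [energy_const hn] using h
  · exact (chartEnergy_congr_of_le P (hu.min hc) hu (fun x ↦ min_le_left _ _) hB
      fun x hx ↦ min_eq_left (hBA hx)).le
  · exact (chartEnergy_congr_of_le P (hu.min hc) hc (fun x ↦ min_le_right _ _) hB
      fun x hx ↦ min_eq_right (by simpa using hBA hx : _ < _).le).le

theorem capacity_union_le [T2Space M] (hn : n ≠ 0) (S : ConformalStructure n M) (K L : Set M) :
    capacity S (K ∪ L) ≤ capacity S K + capacity S L := by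
  simp only [capacity, ENNReal.iInf_add, ENNReal.add_iInf]
  refine le_iInf fun v ↦ le_iInf fun hv ↦ le_iInf fun hvc ↦ le_iInf fun hv1 ↦ ?_
  refine le_iInf fun u ↦ le_iInf fun hu ↦ le_iInf fun huc ↦ le_iInf fun hu1 ↦ ?_
  have hm := hu.max hv
  -- Admissible functions may exceed `1`, for instance `v` on `K`; truncating at `1` restores the
  -- boundary condition.
  refine iInf_le_of_le (fun x ↦ min (max (u x) (v x)) 1) (iInf_le_of_le (hm.min (isLip_const 1))
    (iInf_le_of_le ?_ (iInf_le_of_le ?_ ?_)))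
  · refine HasCompactSupport.of_support_subset_isCompact (huc.isCompact.union hvc.isCompact) ?_
    intro x hx
    by_contra! hx'
    rw [mem_union, not_or] at hx'
    exact hx (by simp [image_eq_zero_of_notMem_tsupport hx'.1,
      image_eq_zero_of_notMem_tsupport hx'.2])
  · rintro x (hx | hx)
    · simp [hu1 x hx]
    · simp [hv1 x hx]
  · exact (energy_min_le hn hm 1).trans (energy_max_le hu hv)

theorem mu_triangle [T2Space M] (hn : n ≠ 0) (S : ConformalStructure n M) (x y z : M) :
    mu S x z ≤ mu S x y + mu S y z := by
  simp only [mu, ENNReal.iInf_add, ENNReal.add_iInf]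
  refine le_iInf fun D ↦ le_iInf fun hD ↦ le_iInf fun hD' ↦ le_iInf fun hy' ↦ le_iInf fun hz ↦ ?_
  refine le_iInf fun C ↦ le_iInf fun hC ↦ le_iInf fun hC' ↦ le_iInf fun hx ↦ le_iInf fun hy ↦ ?_
  exact iInf_le_of_le (C ∪ D) (iInf_le_of_le (hC.union hD) (iInf_le_of_le
    (IsConnected.union ⟨y, hy, hy'⟩ hC' hD') (iInf_le_of_le (Or.inl hx) (iInf_le_of_le (Or.inr hz)
    (capacity_union_le hn S C D)))))

theorem mu_comm (S : ConformalStructure n M) (x y : M) : mu S x y = mu S y x := by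
  have : ∀ x y : M, mu S x y ≤ mu S y x := fun x y ↦ by
    refine le_iInf fun C ↦ le_iInf fun hC ↦ le_iInf fun hC' ↦ le_iInf fun hx ↦ le_iInf fun hy ↦ ?_
    exact iInf_le_of_le C (iInf_le_of_le hC (iInf_le_of_le hC' (iInf_le_of_le hy
      (iInf_le_of_le hx le_rfl))))
  exact le_antisymm (this x y) (this y x)

theorem mu_le_capacity (S : ConformalStructure n M) {C : Set M} (hC : IsCompact C)
    (hC' : IsConnected C) {x y : M} (hx : x ∈ C) (hy : y ∈ C) : mu S x y ≤ capacity S C :=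
  iInf_le_of_le C (iInf_le_of_le hC (iInf_le_of_le hC' (iInf_le_of_le hx
      (iInf_le_of_le hy le_rfl))))

end

/-! ### Comparison with the Euclidean energy on compact sets -/

section

section BilinearForms

variable {n : ℕ}

/-- The pullback of a bilinear form by an endomorphism. -/
def pullback (B : E n →L[ℝ] E n →L[ℝ] ℝ) (D : E n →L[ℝ] E n) : E n →L[ℝ] E n →L[ℝ] ℝ :=
  B.bilinearComp D D

theorem pullback_apply (B : E n →L[ℝ] E n →L[ℝ] ℝ) (D : E n →L[ℝ] E n) (v w : E n) :
    pullback B D v w = B (D v) (D w) := rfl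

/-- `D` carries the gradient for the pulled-back form to the gradient for `B`. The right side is the
chart integrand; the left side expresses it through the coordinate matrix of the metric, which
varies continuously. -/
theorem covDensity_pullback (B : E n →L[ℝ] E n →L[ℝ] ℝ) (hB : ∀ v, v ≠ 0 → 0 < B v v)
    (D : E n →L[ℝ] E n) (hD : Function.Bijective D) (l : E n →L[ℝ] ℝ) :
    covDensity (pullback B D) (l.comp D) = |D.det| * covDensity B l := by
  have hG : ∀ v, v ≠ 0 → 0 < pullback B D v v := fun v hv ↦
    hB _ fun h ↦ hv (hD.1 (h.trans (map_zero D).symm))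
  have hinv : D ((pullback B D).inverse (l.comp D)) = B.inverse l := by
    obtain ⟨v, hv⟩ := hD.2 (B.inverse l)
    have h1 : pullback B D v = l.comp D := by
      ext w
      rw [pullback_apply, hv, (apply_inverse_of_pos B hB l).1]
      rfl
    obtain ⟨e, he⟩ := (apply_inverse_of_pos _ hG (l.comp D)).2
    have h2 : pullback B D ((pullback B D).inverse (l.comp D)) = pullback B D v := by
      rw [(apply_inverse_of_pos _ hG (l.comp D)).1, h1]
    rw [← hv]
    congr 1
    rw [← he] at h2 ⊢
    exact e.injective h2
  have hdet : stdDet (pullback B D) = D.det ^ 2 * stdDet B := gram_det_comp B D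
  rw [covDensity, covDensity, pullback_apply, hinv, hdet, Real.sqrt_mul (sq_nonneg _),
    Real.sqrt_sq_eq_abs]
  ring

/-- For the gradient `v`, `c * ‖v‖ ^ 2 ≤ G v v = l v ≤ ‖l‖ * ‖v‖` gives `‖v‖ ≤ ‖l‖ / c`, hence `G v
v ≤ ‖l‖ ^ 2 / c`. -/
theorem covDensity_le (G : E n →L[ℝ] E n →L[ℝ] ℝ) {c d : ℝ} (hc : 0 < c)
    (hG : ∀ v, c * ‖v‖ ^ 2 ≤ G v v) (hd : stdDet G ≤ d) (l : E n →L[ℝ] ℝ) :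
    covDensity G l ≤ (Real.sqrt c)⁻¹ ^ n * Real.sqrt d * ‖l‖ ^ n := by
  have hpos : ∀ v, v ≠ 0 → 0 < G v v := fun v hv ↦
    (mul_pos hc (pow_pos (norm_pos_iff.2 hv) 2)).trans_le (hG v)
  set v := G.inverse l with hv
  have h1 : G v v = l v := by rw [(apply_inverse_of_pos G hpos l).1]
  have h2 : l v ≤ ‖l‖ * ‖v‖ := (le_abs_self _).trans (l.le_opNorm v)
  have h3 : c * ‖v‖ ≤ ‖l‖ := by
    rcases eq_or_lt_of_le (norm_nonneg v) with h0 | h0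
    · rw [← h0]; simp
    · have := hG v
      nlinarith
  have h4 : Real.sqrt (G v v) ≤ (Real.sqrt c)⁻¹ * ‖l‖ := by
    rw [Real.sqrt_le_left (by positivity), mul_pow, inv_pow, Real.sq_sqrt hc.le, inv_mul_eq_div,
      le_div_iff₀ hc]
    nlinarith [norm_nonneg l, norm_nonneg v]
  calc covDensity G l = Real.sqrt (G v v) ^ n * Real.sqrt (stdDet G) := rfl
    _ ≤ ((Real.sqrt c)⁻¹ * ‖l‖) ^ n * Real.sqrt d := by gcongr
    _ = _ := by rw [mul_pow]; ring

theorem continuous_stdDet : Continuous (stdDet (n := n)) := by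
  unfold stdDet
  refine Continuous.matrix_det (continuous_matrix fun i j ↦ ?_)
  simp only [Matrix.of_apply]
  fun_prop

end BilinearForms

variable {n : ℕ} {M : Type*} [TopologicalSpace M] [ChartedSpace (E n) M]
  [IsManifold 𝓘(ℝ, E n) ∞ M]

theorem continuousOn_symmDeriv {φ : OpenPartialHomeomorph M (E n)}
    (hφ : φ ∈ IsManifold.maximalAtlas 𝓘(ℝ, E n) ∞ M) (v : E n) :
    ContinuousOn (fun y ↦ (⟨φ.symm y, symmDeriv φ y v⟩ : TangentBundle 𝓘(ℝ, E n) M)) φ.target := by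
  have : IsManifold 𝓘(ℝ, E n) 1 M := .of_le (n := ∞) (by simp)
  have hu : UniqueMDiffOn 𝓘(ℝ, E n) φ.target := φ.open_target.uniqueMDiffOn
  have h1 : ContinuousOn (tangentMapWithin 𝓘(ℝ, E n) 𝓘(ℝ, E n) φ.symm φ.target) _ :=
    (contMDiffOn_symm_of_mem_maximalAtlas hφ).continuousOn_tangentMapWithin (by simp) hu
  have h2 : Continuous fun y : E n ↦ (⟨y, v⟩ : TangentBundle 𝓘(ℝ, E n) (E n)) := by
    have h3 : ContDiff ℝ 0 (fun _ : E n ↦ v) := contDiff_const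
    exact (contMDiff_vectorSpace_iff_contDiff.2 h3).continuous
  have h3 : ContinuousOn (tangentMapWithin 𝓘(ℝ, E n) 𝓘(ℝ, E n) φ.symm φ.target ∘
      fun y : E n ↦ (⟨y, v⟩ : TangentBundle 𝓘(ℝ, E n) (E n))) φ.target :=
    h1.comp h2.continuousOn fun y hy ↦ hy
  refine h3.congr fun y hy ↦ ?_
  exact (tangentMapWithin_eq_tangentMap (p := (⟨y, v⟩ : TangentBundle 𝓘(ℝ, E n) (E n))) (hu y hy)
    ((mdifferentiable_of_mem_maximalAtlas hφ).mdifferentiableAt_symm hy)).symm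

theorem continuousOn_pullback (g : LocalMetric n M) {φ : OpenPartialHomeomorph M (E n)}
    (hφ : φ ∈ IsManifold.maximalAtlas 𝓘(ℝ, E n) ∞ M) :
    ContinuousOn (fun y ↦ pullback (g.form (φ.symm y)) (symmDeriv φ y))
      (φ.target ∩ φ.symm ⁻¹' g.dom) := by
  refine continuousOn_clm_apply.2 fun v ↦ continuousOn_clm_apply.2 fun w ↦ ?_
  have hg := g.contMDiffOn.continuousOn.comp (φ.continuousOn_symm.mono inter_subset_left)
    (fun y (hy : y ∈ φ.target ∩ φ.symm ⁻¹' g.dom) ↦ hy.2)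
  have h : ContinuousOn (fun y ↦ Bundle.TotalSpace.mk' ℝ (E := Bundle.Trivial M ℝ) (φ.symm y)
      (g.inner (φ.symm y) (symmDeriv φ y v) (symmDeriv φ y w))) (φ.target ∩ φ.symm ⁻¹' g.dom) :=
    ContinuousOn.clm_bundle_apply₂ (F₁ := E n) (F₂ := E n) hg
      ((continuousOn_symmDeriv hφ v).mono inter_subset_left)
      ((continuousOn_symmDeriv hφ w).mono inter_subset_left)
  intro y hy
  exact ((Bundle.Trivial.trivialization M ℝ).continuousAt (by simp)).snd.comp_continuousWithinAt
    (h y hy)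

/-- On a compact part of a chart, the energy density is controlled by the Euclidean one. -/
theorem exists_energyDensity_le (g : LocalMetric n M) {φ : OpenPartialHomeomorph M (E n)}
    (hφ : φ ∈ IsManifold.maximalAtlas 𝓘(ℝ, E n) ∞ M) {K : Set (E n)} (hK : IsCompact K)
    (hKs : K ⊆ φ.target ∩ φ.symm ⁻¹' g.dom) :
    ∃ C : ℝ, 0 ≤ C ∧ ∀ y ∈ K, ∀ f : M → ℝ,
      |(symmDeriv φ y).det| * covDensity (g.form (φ.symm y)) (differential f (φ.symm y)) ≤
        C * ‖fderiv ℝ (f ∘ φ.symm) y‖ ^ n := by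
  have hG := (continuousOn_pullback g hφ).mono hKs
  set G := fun y ↦ pullback (g.form (φ.symm y)) (symmDeriv φ y) with hGdef
  obtain ⟨d, hd⟩ := (hK.image_of_continuousOn (continuous_stdDet.comp_continuousOn hG)).bddAbove
  have hpos : ∀ p ∈ K ×ˢ Metric.sphere (0 : E n) 1, 0 < G p.1 p.2 p.2 := by
    rintro ⟨y, v⟩ ⟨hy, hv⟩
    have hv0 : v ≠ 0 := by
      rintro rfl
      simp at hv
    refine g.form_pos (hKs hy).2 _ fun h ↦ hv0 ?_
    exact (symmDeriv_bijective hφ (hKs hy).1).1 (h.trans (map_zero _).symm)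
  have hcont : ContinuousOn (fun p : E n × E n ↦ G p.1 p.2 p.2)
      (K ×ˢ Metric.sphere (0 : E n) 1) := by
    have h1 : ContinuousOn (fun p : E n × E n ↦ G p.1) (K ×ˢ Metric.sphere (0 : E n) 1) :=
      hG.comp continuousOn_fst fun p hp ↦ hp.1
    exact (h1.clm_apply continuousOn_snd).clm_apply continuousOn_snd
  -- Uniform ellipticity: a positive lower bound on `K` times the unit sphere, extended to all
  -- vectors by homogeneity.
  obtain ⟨c, hc, hcG⟩ := (hK.prod (isCompact_sphere _ _)).exists_forall_le' hcont hpos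
  have hlow : ∀ y ∈ K, ∀ v, c * ‖v‖ ^ 2 ≤ G y v v := by
    intro y hy v
    rcases eq_or_ne v 0 with rfl | hv
    · simp
    · have hv' : 0 < ‖v‖ := norm_pos_iff.2 hv
      have h := hcG (y, ‖v‖⁻¹ • v) ⟨hy, by simp [norm_smul, hv'.ne']⟩
      simp only [map_smul, smul_apply, smul_eq_mul] at h
      rw [← mul_assoc, ← mul_inv, inv_mul_eq_div, le_div_iff₀ (by positivity)] at h
      rwa [sq]
  refine ⟨(Real.sqrt c)⁻¹ ^ n * Real.sqrt d, by positivity, fun y hy f ↦ ?_⟩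
  rw [← covDensity_pullback _ (g.form_pos (hKs hy).2) _ (symmDeriv_bijective hφ (hKs hy).1),
    fderiv_comp_symm hφ f (hKs hy).1]
  exact covDensity_le _ hc (hlow y hy) (hd (mem_image_of_mem _ hy)) _

end

/-! ### The logarithmic cutoff and its energy -/

section

section Cutoff

/-- The radial profile of the logarithmic cutoff: `1` on `[0, r]` and `0` on `[R, ∞)`. -/
def logCutoff (r R s : ℝ) : ℝ :=
  max 0 ((Real.log R - Real.log (max s r)) / Real.log (R / r))

variable {r R : ℝ}

theorem logCutoff_of_le (hr : 0 < r) (hrR : r < R) {s : ℝ} (hs : s ≤ r) : logCutoff r R s = 1 := by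
  have hR := hr.trans hrR
  have hL : 0 < Real.log (R / r) := Real.log_pos ((one_lt_div hr).2 hrR)
  rw [logCutoff, max_eq_right hs, ← Real.log_div hR.ne' hr.ne', div_self hL.ne']
  simp

theorem logCutoff_of_ge (hr : 0 < r) (hrR : r < R) {s : ℝ} (hs : R ≤ s) : logCutoff r R s = 0 := by
  have hR := hr.trans hrR
  have hL : 0 < Real.log (R / r) := Real.log_pos ((one_lt_div hr).2 hrR)
  rw [logCutoff, max_eq_left (hrR.le.trans hs)]
  have := Real.log_le_log hR hs
  exact max_eq_left (div_nonpos_of_nonpos_of_nonneg (by linarith) hL.le)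

theorem abs_log_sub_log_le {m a b : ℝ} (hm : 0 < m) (ha : m ≤ a) (hb : m ≤ b) :
    |Real.log a - Real.log b| ≤ |a - b| / m := by
  wlog hab : b ≤ a generalizing a b
  · rw [abs_sub_comm, abs_sub_comm a]
    exact this hb ha (not_le.1 hab).le
  have hb0 := hm.trans_le hb
  have ha0 := hm.trans_le ha
  rw [abs_of_nonneg (sub_nonneg.2 (Real.log_le_log hb0 hab)), abs_of_nonneg (sub_nonneg.2 hab),
    ← Real.log_div ha0.ne' hb0.ne']
  calc Real.log (a / b) ≤ a / b - 1 := Real.log_le_sub_one_of_pos (by positivity)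
    _ = (a - b) / b := by field_simp
    _ ≤ (a - b) / m := div_le_div_of_nonneg_left (sub_nonneg.2 hab) hm hb

/-- The logarithm is `m⁻¹`-Lipschitz on `[m, ∞)`. Taking `m = r` gives the global Lipschitz
constant, and `m = ‖y‖ / 2` the decay of the derivative at `y`. -/
theorem abs_logCutoff_sub_le (hr : 0 < r) (hrR : r < R) {m s t : ℝ} (hm : 0 < m)
    (hs : m ≤ max s r) (ht : m ≤ max t r) :
    |logCutoff r R s - logCutoff r R t| ≤ (m * Real.log (R / r))⁻¹ * |s - t| := by
  have hL : 0 < Real.log (R / r) := Real.log_pos ((one_lt_div hr).2 hrR)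
  rw [logCutoff, logCutoff, max_comm 0, max_comm 0]
  refine (abs_max_sub_max_le_abs _ _ _).trans ?_
  rw [← sub_div, abs_div, abs_of_pos hL, mul_inv, mul_comm m⁻¹, mul_assoc, inv_mul_eq_div,
    inv_mul_eq_div]
  gcongr
  rw [sub_sub_sub_cancel_left]
  have h := abs_log_sub_log_le hm ht hs
  refine h.trans (div_le_div_of_nonneg_right ?_ hm.le)
  rw [abs_sub_comm s]
  exact abs_max_sub_max_le_abs _ _ _

variable {n : ℕ}

theorem lipschitzWith_logCutoff_norm (hr : 0 < r) (hrR : r < R) :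
    LipschitzWith (r * Real.log (R / r))⁻¹.toNNReal fun z : E n ↦ logCutoff r R ‖z‖ := by
  have hL : 0 < Real.log (R / r) := Real.log_pos ((one_lt_div hr).2 hrR)
  refine LipschitzWith.of_dist_le_mul fun y z ↦ ?_
  rw [Real.coe_toNNReal _ (by positivity), Real.dist_eq, dist_eq_norm]
  refine (abs_logCutoff_sub_le hr hrR hr (le_max_right _ _) (le_max_right _ _)).trans ?_
  gcongr
  exact abs_norm_sub_norm_le y z

theorem norm_fderiv_logCutoff_le (hr : 0 < r) (hrR : r < R) (y : E n) :
    ‖fderiv ℝ (fun z : E n ↦ logCutoff r R ‖z‖) y‖ ≤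
      (Icc r R).indicator (fun s ↦ 2 * (s * Real.log (R / r))⁻¹) ‖y‖ := by
  have hL : 0 < Real.log (R / r) := Real.log_pos ((one_lt_div hr).2 hrR)
  by_cases hy : ‖y‖ ∈ Icc r R
  · rw [indicator_of_mem hy]
    have hy0 : 0 < ‖y‖ := hr.trans_le hy.1
    -- The factor `2` pays for a Lipschitz bound on a whole neighbourhood, where `‖z‖ > ‖y‖ / 2`.
    -- Points with `‖y‖ = r` or `‖y‖ = R`, where differentiability may fail, are covered as well.
    refine norm_fderiv_le_of_lip' ℝ (by positivity) ?_
    filter_upwards [continuous_norm.continuousAt.eventually (lt_mem_nhds (half_lt_self hy0))]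
      with z hz
    have h := abs_logCutoff_sub_le hr hrR (half_pos hy0) (hz.le.trans (le_max_left _ r))
      ((half_le_self hy0.le).trans (le_max_left _ r))
    refine h.trans ?_
    rw [show (‖y‖ / 2 * Real.log (R / r))⁻¹ = 2 * (‖y‖ * Real.log (R / r))⁻¹ by field_simp]
    gcongr
    exact abs_norm_sub_norm_le z y
  · rw [indicator_of_notMem hy]
    have hconst : ∃ c : ℝ, (fun z : E n ↦ logCutoff r R ‖z‖) =ᶠ[𝓝 y] fun _ ↦ c := by
      rw [mem_Icc, not_and_or, not_le, not_le] at hy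
      rcases hy with hy | hy
      · refine ⟨1, ?_⟩
        filter_upwards [continuous_norm.continuousAt.eventually (gt_mem_nhds hy)] with z hz
        exact logCutoff_of_le hr hrR hz.le
      · refine ⟨0, ?_⟩
        filter_upwards [continuous_norm.continuousAt.eventually (lt_mem_nhds hy)] with z hz
        exact logCutoff_of_ge hr hrR hz.le
    obtain ⟨c, hc⟩ := hconst
    rw [hc.fderiv_eq]
    simp

/-- In polar coordinates the radial integrand is `s ^ (n - 1) * (s ^ n)⁻¹ = s⁻¹`, with integral `log
(R / r)`. -/
theorem lintegral_norm_pow_inv (hn : n ≠ 0) (hr : 0 < r) (hrR : r < R) :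
    ∫⁻ y : E n, ENNReal.ofReal ((Icc r R).indicator (fun s ↦ (s ^ n)⁻¹) ‖y‖) =
      ENNReal.ofReal (n * (volume.real (Metric.ball (0 : E n) 1) * Real.log (R / r))) := by
  have : Nonempty (Fin n) := ⟨⟨0, Nat.pos_of_ne_zero hn⟩⟩
  have hdim : Module.finrank ℝ (E n) = n := by simp
  have hind : ∀ s : ℝ, s ^ (n - 1) • (Icc r R).indicator (fun s ↦ (s ^ n)⁻¹) s =
      (Icc r R).indicator (fun s ↦ s⁻¹) s := by
    intro s
    by_cases hs : s ∈ Icc r R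
    · have hs0 : s ≠ 0 := (hr.trans_le hs.1).ne'
      obtain ⟨m, rfl⟩ := Nat.exists_eq_succ_of_ne_zero hn
      simp only [indicator_of_mem hs, smul_eq_mul, Nat.succ_eq_add_one, Nat.add_sub_cancel]
      field_simp
      ring
    · simp [indicator_of_notMem hs]
  have hIcc : Icc r R ∩ Ioi 0 = Icc r R :=
    inter_eq_left.2 fun s hs ↦ hr.trans_le hs.1
  have hint : IntegrableOn (fun s : ℝ ↦ s⁻¹) (Icc r R) :=
    (continuousOn_inv₀.mono fun s hs ↦ (hr.trans_le hs.1).ne').integrableOn_compact isCompact_Icc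
  have hI : Integrable fun y : E n ↦ (Icc r R).indicator (fun s ↦ (s ^ n)⁻¹) ‖y‖ := by
    rw [integrable_fun_norm_addHaar (μ := volume) (E := E n)
      (f := (Icc r R).indicator (fun s ↦ (s ^ n)⁻¹)), hdim]
    simp only [hind]
    exact ((integrable_indicator_iff measurableSet_Icc).2 hint).integrableOn
  rw [← ofReal_integral_eq_lintegral_ofReal hI
    (Filter.Eventually.of_forall fun y ↦ indicator_nonneg
      (fun s hs ↦ inv_nonneg.2 (pow_nonneg (hr.le.trans hs.1) n)) _),
    integral_fun_norm_addHaar (μ := volume) (E := E n)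
      (Icc r R |>.indicator (fun s ↦ (s ^ n)⁻¹)), hdim]
  simp only [hind]
  rw [setIntegral_indicator measurableSet_Icc, inter_comm, hIcc, integral_Icc_eq_integral_Ioc,
    ← intervalIntegral.integral_of_le hrR.le, integral_inv_of_pos hr (hr.trans hrR)]
  simp

theorem lintegral_fderiv_logCutoff_le (hn : n ≠ 0) (hr : 0 < r) (hrR : r < R) {C : ℝ}
    (hC : 0 ≤ C) (p : E n) :
    ∫⁻ y : E n, ENNReal.ofReal (C * ‖fderiv ℝ (fun z : E n ↦ logCutoff r R ‖z - p‖) y‖ ^ n) ≤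
      ENNReal.ofReal (C * (2 * (Real.log (R / r))⁻¹) ^ n *
        (n * (volume.real (Metric.ball (0 : E n) 1) * Real.log (R / r)))) := by
  have hL : 0 < Real.log (R / r) := Real.log_pos ((one_lt_div hr).2 hrR)
  have htrans : ∀ y : E n, fderiv ℝ (fun z : E n ↦ logCutoff r R ‖z - p‖) y =
      fderiv ℝ (fun z : E n ↦ logCutoff r R ‖z‖) (y - p) := fun y ↦
    fderiv_comp_sub (f := fun z : E n ↦ logCutoff r R ‖z‖) p
  simp only [htrans]
  rw [lintegral_sub_right_eq_self (fun y : E n ↦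
    ENNReal.ofReal (C * ‖fderiv ℝ (fun z : E n ↦ logCutoff r R ‖z‖) y‖ ^ n)) p,
    ENNReal.ofReal_mul (by positivity), ← lintegral_norm_pow_inv hn hr hrR,
    ← lintegral_const_mul' _ _ ENNReal.ofReal_ne_top]
  refine lintegral_mono fun y ↦ ?_
  rw [← ENNReal.ofReal_mul (by positivity)]
  refine ENNReal.ofReal_le_ofReal ?_
  rw [mul_assoc]
  refine mul_le_mul_of_nonneg_left ?_ hC
  refine (pow_le_pow_left₀ (norm_nonneg _) (norm_fderiv_logCutoff_le hr hrR y) n).trans ?_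
  by_cases hy : ‖y‖ ∈ Icc r R
  · simp only [indicator_of_mem hy]
    rw [mul_inv, ← inv_pow, ← mul_pow]
    apply le_of_eq
    ring
  · simp [indicator_of_notMem hy, hn]

end Cutoff

/-! ### Transplanting functions from a chart to the manifold -/

variable {n : ℕ} {M : Type*} [TopologicalSpace M] [ChartedSpace (E n) M]
  [IsManifold 𝓘(ℝ, E n) ∞ M]

/-- The function on a manifold that is `F` in the chart `φ`, extended by zero. -/
def extendChart (φ : OpenPartialHomeomorph M (E n)) (F : E n → ℝ) : M → ℝ :=
  φ.source.indicator (F ∘ φ)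

section ExtendChart

variable {φ : OpenPartialHomeomorph M (E n)} {F : E n → ℝ} {K : Set (E n)}

omit [ChartedSpace (E n) M] [IsManifold 𝓘(ℝ, E n) ∞ M] in
theorem extendChart_eq_zero (hF : ∀ y ∉ K, F y = 0) {x : M} (hx : x ∉ φ.symm '' K) :
    extendChart φ F x = 0 := by
  by_cases hxs : x ∈ φ.source
  · rw [extendChart, indicator_of_mem hxs]
    exact hF _ fun h ↦ hx ⟨φ x, h, φ.left_inv hxs⟩
  · exact indicator_of_notMem hxs _

omit [ChartedSpace (E n) M] [IsManifold 𝓘(ℝ, E n) ∞ M] in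
theorem isCompact_symm_image (hK : IsCompact K) (hKφ : K ⊆ φ.target) :
    IsCompact (φ.symm '' K) :=
  hK.image_of_continuousOn (φ.continuousOn_symm.mono hKφ)

omit [ChartedSpace (E n) M] [IsManifold 𝓘(ℝ, E n) ∞ M] in
theorem extendChart_eventuallyEq_zero [T2Space M] (hK : IsCompact K) (hKφ : K ⊆ φ.target)
    (hF : ∀ y ∉ K, F y = 0) {x : M} (hx : x ∉ φ.symm '' K) :
    extendChart φ F =ᶠ[𝓝 x] fun _ ↦ 0 := by
  filter_upwards [(isCompact_symm_image hK hKφ).isClosed.isOpen_compl.mem_nhds hx] with z hz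
  exact extendChart_eq_zero hF hz

omit [ChartedSpace (E n) M] [IsManifold 𝓘(ℝ, E n) ∞ M] in
theorem hasCompactSupport_extendChart [T2Space M] (hK : IsCompact K) (hKφ : K ⊆ φ.target)
    (hF : ∀ y ∉ K, F y = 0) : HasCompactSupport (extendChart φ F) :=
  HasCompactSupport.intro (isCompact_symm_image hK hKφ) fun _ hx ↦ extendChart_eq_zero hF hx

omit [ChartedSpace (E n) M] [IsManifold 𝓘(ℝ, E n) ∞ M] in
theorem extendChart_comp_symm {y : E n} (hy : y ∈ φ.target) :
    extendChart φ F (φ.symm y) = F y := by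
  rw [extendChart, indicator_of_mem (φ.map_target hy), Function.comp_apply, φ.right_inv hy]

omit [IsManifold 𝓘(ℝ, E n) ∞ M] in
-- Inside `φ.source` the transition map is smooth, hence locally Lipschitz. Elsewhere the function
-- vanishes locally, since `φ.symm '' K` is compact and so closed in the Hausdorff space `M`.
theorem isLip_extendChart [T2Space M] (hφ : φ ∈ IsManifold.maximalAtlas 𝓘(ℝ, E n) ∞ M)
    (hK : IsCompact K) (hKφ : K ⊆ φ.target) (hF : ∀ y ∉ K, F y = 0) {L : NNReal}
    (hL : LipschitzWith L F) : IsLip n (extendChart φ F) := by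
  intro ψ hψ y hy
  rw [ψ.open_target.nhdsWithin_eq hy]
  by_cases hx : ψ.symm y ∈ φ.source
  · have hopen : IsOpen (ψ.target ∩ ψ.symm ⁻¹' φ.source) :=
      ψ.symm.isOpen_inter_preimage φ.open_source
    have hT : ContDiffAt ℝ 1 (φ ∘ ψ.symm) y :=
      ((contDiffOn_transition hψ hφ).contDiffAt (hopen.mem_nhds ⟨hy, hx⟩)).of_le (by simp)
    obtain ⟨N, t, ht, hN⟩ := hT.exists_lipschitzOnWith
    refine ⟨L * N, t ∩ (ψ.target ∩ ψ.symm ⁻¹' φ.source),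
      Filter.inter_mem ht (hopen.mem_nhds ⟨hy, hx⟩), ?_⟩
    have heq : ∀ z ∈ t ∩ (ψ.target ∩ ψ.symm ⁻¹' φ.source),
        (extendChart φ F ∘ ψ.symm) z = (F ∘ φ ∘ ψ.symm) z := fun z hz ↦
      indicator_of_mem (s := φ.source) (a := ψ.symm z) hz.2.2 _
    intro a ha b hb
    rw [heq a ha, heq b hb]
    exact hL.comp_lipschitzOnWith hN ha.1 hb.1
  · have hx' : ψ.symm y ∉ φ.symm '' K := by
      rintro ⟨z, hz, hzx⟩
      exact hx (hzx ▸ φ.map_target (hKφ hz))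
    have h0 := (ψ.continuousAt_symm hy).eventually (extendChart_eventuallyEq_zero hK hKφ hF hx')
    refine ⟨0, _, h0, fun a ha b hb ↦ ?_⟩
    have ha' : extendChart φ F (ψ.symm a) = 0 := ha
    have hb' : extendChart φ F (ψ.symm b) = 0 := hb
    simp [ha', hb']

theorem energy_extendChart_le [T2Space M] (hn : n ≠ 0) (S : ConformalStructure n M)
    {g : LocalMetric n M} (hg : g ∈ S.localMetrics)
    (hφ : φ ∈ IsManifold.maximalAtlas 𝓘(ℝ, E n) ∞ M)
    (hK : IsCompact K) (hKφ : K ⊆ φ.target ∩ φ.symm ⁻¹' g.dom) (hF : ∀ y ∉ K, F y = 0) {C : ℝ}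
    (hC : ∀ y ∈ K, ∀ f : M → ℝ,
      |(symmDeriv φ y).det| * covDensity (g.form (φ.symm y)) (differential f (φ.symm y)) ≤
        C * ‖fderiv ℝ (f ∘ φ.symm) y‖ ^ n) :
    energy S (extendChart φ F) ≤ ∫⁻ y, ENNReal.ofReal (C * ‖fderiv ℝ F y‖ ^ n) := by
  have hKt : K ⊆ φ.target := hKφ.trans inter_subset_left
  set f := extendChart φ F
  set A := φ.symm '' K
  have hAc : IsClosed A := (isCompact_symm_image hK hKt).isClosed
  have hA : MeasurableSet[borel M] A := by
    borelize M
    exact hAc.measurableSet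
  have hA' : MeasurableSet[borel M] Aᶜ := by
    borelize M
    exact MeasurableSet.compl hA
  have hAφ : A ⊆ φ.source ∩ g.dom := by
    rintro _ ⟨y, hy, rfl⟩
    exact ⟨φ.map_target (hKt hy), (hKφ hy).2⟩
  have hAK : φ.target ∩ φ.symm ⁻¹' A ⊆ K := by
    rintro y ⟨hy, z, hz, hzy⟩
    rwa [← φ.symm.injOn (hKt hz) hy hzy]
  refine iSup_le fun k ↦ iSup_le fun P ↦ iSup_le fun hP ↦ ?_
  -- Off `A` the function is locally zero, so only `A` contributes, and there each piece can be
  -- moved to the single chart `φ`; disjointness then bounds the sum by one integral.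
  have hpiece : ∀ i, chartEnergy (P i).metric (P i).chart (P i).carrier f =
      chartEnergy g φ ((P i).inter A hA).carrier f := by
    intro i
    have h : (P i).carrier = ((P i).inter A hA).carrier ∪ ((P i).inter Aᶜ hA').carrier :=
      (inter_union_compl _ _).symm
    have hd : Disjoint ((P i).inter A hA).carrier ((P i).inter Aᶜ hA').carrier :=
      disjoint_compl_right.mono inter_subset_right inter_subset_right
    conv_lhs => rw [h]
    rw [chartEnergy_union ((P i).inter Aᶜ hA').measurable_carrier hd,
      chartEnergy_eq_zero hn ((P i).inter Aᶜ hA').measurable_carrier, add_zero]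
    · exact chartEnergy_eq S (P i).metric_mem hg (P i).chart_mem hφ
        ((P i).inter A hA).measurable_carrier ((P i).inter A hA).carrier_subset
        (inter_subset_right.trans hAφ) f
    · intro x hx
      exact ((extendChart_eventuallyEq_zero hK hKt hF hx.2).mfderiv_eq
        (I := 𝓘(ℝ, E n)) (I' := 𝓘(ℝ, ℝ))).trans mfderiv_const
  have hmeas : ∀ i, MeasurableSet (φ.target ∩ φ.symm ⁻¹' ((P i).inter A hA).carrier) := fun i ↦
    measurableSet_target_inter φ ((P i).inter A hA).measurable_carrier
  have hdisj : Pairwise fun i j ↦ Disjoint (φ.target ∩ φ.symm ⁻¹' ((P i).inter A hA).carrier)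
      (φ.target ∩ φ.symm ⁻¹' ((P j).inter A hA).carrier) := fun i j hij ↦
    ((hP hij).preimage φ.symm).mono
      (inter_subset_right.trans (preimage_mono inter_subset_left))
      (inter_subset_right.trans (preimage_mono inter_subset_left))
  have hsub : ⋃ i, φ.target ∩ φ.symm ⁻¹' ((P i).inter A hA).carrier ⊆ φ.target ∩ φ.symm ⁻¹' A :=
    iUnion_subset fun i ↦ inter_subset_inter_right _ (preimage_mono inter_subset_right)
  simp only [hpiece, chartEnergy_eq_covDensity]
  rw [← tsum_fintype (L := .unconditional _), ← lintegral_iUnion hmeas hdisj]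
  refine (lintegral_mono_set hsub).trans ?_
  refine le_trans ?_ (setLIntegral_le_lintegral (φ.target ∩ φ.symm ⁻¹' A) _)
  refine setLIntegral_mono' (measurableSet_target_inter φ hA) fun y hy ↦ ?_
  have hev : f ∘ φ.symm =ᶠ[𝓝 y] F := by
    filter_upwards [φ.open_target.mem_nhds hy.1] with z hz
    exact extendChart_comp_symm hz
  have h := hC y (hAK hy) f
  rw [hev.fderiv_eq] at h
  exact ENNReal.ofReal_le_ofReal h

end ExtendChart

end

/-! ### The metric and its topology -/

section

variable {n : ℕ} {M : Type*} [TopologicalSpace M] [ChartedSpace (E n) M]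
  [IsManifold 𝓘(ℝ, E n) ∞ M]

theorem exists_closedBall_subset (S : ConformalStructure n M) {U : Set M} {x : M} (hU : U ∈ 𝓝 x) :
    ∃ g ∈ S.localMetrics, ∃ R > 0, Metric.closedBall (chartAt (E n) x x) R ⊆
      (chartAt (E n) x).target ∩ (chartAt (E n) x).symm ⁻¹' (g.dom ∩ U) := by
  obtain ⟨g, hg, hxg⟩ := S.cover x
  have hx := mem_chart_target (E n) x
  have hinv := (chartAt (E n) x).left_inv (mem_chart_source (E n) x)
  have h : (chartAt (E n) x).target ∩ (chartAt (E n) x).symm ⁻¹' (g.dom ∩ U) ∈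
      𝓝 (chartAt (E n) x x) := by
    refine Filter.inter_mem ((chartAt (E n) x).open_target.mem_nhds hx)
      ((chartAt (E n) x).continuousAt_symm hx ?_)
    rw [hinv]
    exact Filter.inter_mem (g.isOpen_dom.mem_nhds hxg) hU
  obtain ⟨R, hR, hRs⟩ := Metric.nhds_basis_closedBall.mem_iff.1 h
  exact ⟨g, hg, R, hR, hRs⟩

/-- Small coordinate balls have small capacity. -/
theorem eventually_mu_le [T2Space M] (hn : 2 ≤ n) (S : ConformalStructure n M) (x : M) {ε : ℝ}
    (hε : 0 < ε) : ∀ᶠ y in 𝓝 x, mu S x y ≤ ENNReal.ofReal ε := by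
  have hn0 : n ≠ 0 := by omega
  obtain ⟨g, hg, R, hR, hRs⟩ := exists_closedBall_subset S (Filter.univ_mem (f := 𝓝 x))
  rw [inter_univ] at hRs
  have hφ := IsManifold.chart_mem_maximalAtlas (I := 𝓘(ℝ, E n)) (n := ∞) x
  set φ := chartAt (E n) x
  set p := φ x
  obtain ⟨C, hC0, hC⟩ := exists_energyDensity_le g hφ (isCompact_closedBall p R) hRs
  set V := volume.real (Metric.ball (0 : E n) 1)
  -- `L` will be `log (R / r)`. The cutoff has energy at most `C * 2 ^ n * (n * V) * L⁻¹ ^ n * L`;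
  -- since `L ≥ 1` and `n ≥ 2`, `L⁻¹ ^ n * L ≤ L⁻¹`.
  obtain ⟨L, hL1, hL⟩ : ∃ L : ℝ, 1 ≤ L ∧ C * 2 ^ n * (n * V) / ε ≤ L :=
    ⟨max 1 _, le_max_left _ _, le_max_right _ _⟩
  rw [div_le_iff₀ hε] at hL
  have hL0 : 0 < L := one_pos.trans_le hL1
  set r := R * Real.exp (-L) with hr_def
  have hr : 0 < r := by positivity
  have hrR : r < R := mul_lt_of_lt_one_right hR (Real.exp_lt_one_iff.2 (by linarith))
  have hlog : Real.log (R / r) = L := by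
    rw [hr_def, ← div_div, div_self hR.ne', one_div, ← Real.exp_neg, neg_neg, Real.log_exp]
  set F : E n → ℝ := fun z ↦ logCutoff r R ‖z - p‖
  have hF0 : ∀ y ∉ Metric.closedBall p R, F y = 0 := fun y hy ↦ by
    rw [Metric.mem_closedBall, not_le, dist_eq_norm] at hy
    exact logCutoff_of_ge hr hrR hy.le
  have hFL : LipschitzWith _ F :=
    (lipschitzWith_logCutoff_norm hr hrR).comp (LipschitzWith.id.sub (LipschitzWith.const p))
  have hsub : Metric.closedBall p r ⊆ φ.target :=
    (Metric.closedBall_subset_closedBall hrR.le).trans (hRs.trans inter_subset_left)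
  have hcap : capacity S (φ.symm '' Metric.closedBall p r) ≤ ENNReal.ofReal ε := by
    refine iInf_le_of_le (extendChart φ F) (iInf_le_of_le (isLip_extendChart hφ
      (isCompact_closedBall p R) (hRs.trans inter_subset_left) hF0 hFL) (iInf_le_of_le
      (hasCompactSupport_extendChart (isCompact_closedBall p R) (hRs.trans inter_subset_left) hF0)
      (iInf_le_of_le ?_ ?_)))
    · rintro _ ⟨y, hy, rfl⟩
      rw [extendChart_comp_symm (hsub hy)]
      exact logCutoff_of_le hr hrR (by simpa [dist_eq_norm] using hy)
    · refine (energy_extendChart_le hn0 S hg hφ (isCompact_closedBall p R) hRs hF0 hC).trans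
        ((lintegral_fderiv_logCutoff_le hn0 hr hrR hC0 p).trans (ENNReal.ofReal_le_ofReal ?_))
      rw [hlog]
      have hpow : L⁻¹ ^ n * L ≤ L⁻¹ := by
        obtain ⟨m, rfl⟩ := Nat.exists_eq_add_of_le hn
        have h1 : L⁻¹ ^ m ≤ 1 := pow_le_one₀ (by positivity) (inv_le_one_of_one_le₀ hL1)
        calc L⁻¹ ^ (2 + m) * L = L⁻¹ ^ m * L⁻¹ := by
              rw [pow_add, pow_two]
              linear_combination (L⁻¹ * L⁻¹ ^ m) * inv_mul_cancel₀ hL0.ne'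
          _ ≤ 1 * L⁻¹ := by gcongr
          _ = L⁻¹ := one_mul _
      calc C * (2 * L⁻¹) ^ n * (n * (V * L)) = C * 2 ^ n * (n * V) * (L⁻¹ ^ n * L) := by
            rw [mul_pow]; ring
        _ ≤ C * 2 ^ n * (n * V) * L⁻¹ := by gcongr
        _ ≤ L * ε * L⁻¹ := by gcongr
        _ = ε := by field_simp
  have hnhds : φ.symm '' Metric.closedBall p r ∈ 𝓝 x := by
    have h := φ.symm.image_mem_nhds (x := p) (mem_chart_target (E n) x)
      (Metric.closedBall_mem_nhds p hr)
    rwa [φ.left_inv (mem_chart_source (E n) x)] at h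
  filter_upwards [hnhds] with y hy
  refine (mu_le_capacity S (isCompact_symm_image (isCompact_closedBall p r) hsub) ?_
    (mem_of_mem_nhds hnhds) hy).trans hcap
  have hconn : IsConnected (Metric.closedBall p r) :=
    ⟨⟨p, Metric.mem_closedBall_self hr.le⟩, (convex_closedBall p r).isPreconnected⟩
  exact hconn.image _ (φ.continuousOn_symm.mono hsub)

theorem mu_self [T2Space M] (hn : 2 ≤ n) (S : ConformalStructure n M) (x : M) : mu S x x = 0 := by
  refine le_antisymm (ENNReal.le_of_forall_pos_le_add fun ε hε _ ↦ ?_) zero_le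
  rw [zero_add, ← ENNReal.ofReal_coe_nnreal]
  exact (eventually_mu_le hn S x (NNReal.coe_pos.2 hε)).self_of_nhds

/-- By local finiteness and the triangle inequality, the points at finite distance from `x` form a
nonempty clopen set. -/
theorem mu_lt_top [T2Space M] [ConnectedSpace M] (hn : 2 ≤ n) (S : ConformalStructure n M)
    (x y : M) : mu S x y < ⊤ := by
  have hn0 : n ≠ 0 := by omega
  have hloc : ∀ z : M, ∀ᶠ w in 𝓝 z, mu S z w < ⊤ := fun z ↦
    (eventually_mu_le hn S z one_pos).mono fun w hw ↦ hw.trans_lt ENNReal.ofReal_lt_top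
  have hopen : IsOpen {z | mu S x z < ⊤} := isOpen_iff_mem_nhds.2 fun z hz ↦
    (hloc z).mono fun w hw ↦ (mu_triangle hn0 S x z w).trans_lt (ENNReal.add_lt_top.2 ⟨hz, hw⟩)
  have hclosed : IsClosed {z | mu S x z < ⊤} := by
    rw [← isOpen_compl_iff, isOpen_iff_mem_nhds]
    intro z hz
    filter_upwards [hloc z] with w hw hxw
    exact hz ((mu_triangle hn0 S x w z).trans_lt
      (ENNReal.add_lt_top.2 ⟨hxw, (mu_comm S w z).trans_lt hw⟩))
  have huniv := IsClopen.eq_univ ⟨hclosed, hopen⟩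
    ⟨x, show mu S x x < ⊤ by rw [mu_self hn]; exact ENNReal.zero_lt_top⟩
  exact (huniv ▸ mem_univ y : y ∈ {z | mu S x z < ⊤})

/-- The metric `μ_M` of a connected conformal manifold of Class II. -/
@[reducible] def muMetric [T2Space M] [ConnectedSpace M] (hn : 2 ≤ n) (S : ConformalStructure n M)
    (hS : IsClassII S) : MetricSpace M where
  dist x y := (mu S x y).toReal
  dist_self x := by simp [mu_self hn]
  dist_comm x y := by rw [mu_comm]
  dist_triangle x y z := by
    rw [← ENNReal.toReal_add (mu_lt_top hn S x y).ne (mu_lt_top hn S y z).ne]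
    exact ENNReal.toReal_mono (ENNReal.add_lt_top.2 ⟨mu_lt_top hn S x y, mu_lt_top hn S y z⟩).ne
      (mu_triangle (by omega) S x y z)
  eq_of_dist_eq_zero {x y} h := by
    by_contra hxy
    refine hS ⟨x, y, hxy, ?_⟩
    exact ((ENNReal.toReal_eq_zero_iff _).1 h).resolve_right (mu_lt_top hn S x y).ne

theorem continuous_mu_toReal [T2Space M] [ConnectedSpace M] (hn : 2 ≤ n)
    (S : ConformalStructure n M) (x : M) : Continuous fun y ↦ (mu S x y).toReal := by
  have hn0 : n ≠ 0 := by omega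
  have htri : ∀ y z, (mu S x z).toReal ≤ (mu S x y).toReal + (mu S y z).toReal := fun y z ↦ by
    rw [← ENNReal.toReal_add (mu_lt_top hn S x y).ne (mu_lt_top hn S y z).ne]
    exact ENNReal.toReal_mono (ENNReal.add_lt_top.2 ⟨mu_lt_top hn S x y, mu_lt_top hn S y z⟩).ne
      (mu_triangle hn0 S x y z)
  refine continuous_iff_continuousAt.2 fun y ↦ Metric.tendsto_nhds.2 fun ε hε ↦ ?_
  filter_upwards [eventually_mu_le hn S y (half_pos hε)] with z hz
  have h1 := ENNReal.toReal_le_of_le_ofReal (half_pos hε).le hz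
  have h2 := htri y z
  have h3 := htri z y
  rw [mu_comm S z y] at h3
  rw [Real.dist_eq, abs_lt]
  constructor <;> linarith

/-- In Class II, the points outside a neighbourhood of `x` stay at a positive distance. -/
theorem exists_mu_lt_imp_mem [T2Space M] [ConnectedSpace M] (hn : 2 ≤ n)
    (S : ConformalStructure n M) (hS : IsClassII S) {U : Set M} {x : M} (hU : U ∈ 𝓝 x) :
    ∃ δ > 0, ∀ y, (mu S x y).toReal < δ → y ∈ U := by
  obtain ⟨g, hg, R, hR, hRs⟩ := exists_closedBall_subset S hU
  set φ := chartAt (E n) x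
  set p := φ x
  have hsub : Metric.closedBall p R ⊆ φ.target := hRs.trans inter_subset_left
  have hsph : Metric.sphere p R ⊆ Metric.closedBall p R := Metric.sphere_subset_closedBall
  have hxp : φ.symm p = x := φ.left_inv (mem_chart_source (E n) x)
  have hpos : ∀ z ∈ φ.symm '' Metric.sphere p R, 0 < (mu S x z).toReal := by
    rintro _ ⟨z, hz, rfl⟩
    refine ENNReal.toReal_pos (fun h ↦ hS ⟨x, φ.symm z, fun hxz ↦ ?_, h⟩) (mu_lt_top hn S _ _).ne
    have : p = z := φ.symm.injOn (mem_chart_target (E n) x) (hsub (hsph hz)) (hxp.trans hxz)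
    rw [← this, Metric.mem_sphere, dist_self] at hz
    exact hR.ne hz
  -- A positive continuous function on the compact coordinate sphere is bounded below by some `δ >
  -- 0`.
  obtain ⟨δ, hδ, hδS⟩ := (isCompact_symm_image (isCompact_sphere p R)
    (hsph.trans hsub)).exists_forall_le' (continuous_mu_toReal hn S x).continuousOn hpos
  refine ⟨δ, hδ, fun y hy ↦ ?_⟩
  by_contra hyU
  have hyK : y ∉ φ.symm '' Metric.closedBall p R := by
    rintro ⟨z, hz, rfl⟩
    exact hyU (hRs hz).2.2
  have hopen : IsOpen (φ.symm '' Metric.ball p R) :=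
    φ.symm.isOpen_image_of_subset_source Metric.isOpen_ball
      (Metric.ball_subset_closedBall.trans hsub)
  refine hy.not_ge ?_
  rw [← ENNReal.ofReal_le_iff_le_toReal (mu_lt_top hn S x y).ne]
  refine le_iInf fun D ↦ le_iInf fun hD ↦ le_iInf fun hDc ↦ le_iInf fun hxD ↦ le_iInf fun hyD ↦ ?_
  -- Otherwise the open ball and the complement of the closed ball would disconnect `D`. Since `D`
  -- is itself a continuum through `x` and `z`, its capacity is at least `mu S x z`, hence at least
  -- `δ`.
  obtain ⟨z, hzD, hz⟩ : (D ∩ φ.symm '' Metric.sphere p R).Nonempty := by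
    by_contra hne
    have hcover : D ⊆ φ.symm '' Metric.ball p R ∪ (φ.symm '' Metric.closedBall p R)ᶜ := by
      intro z hz
      by_cases hzK : z ∈ φ.symm '' Metric.closedBall p R
      · obtain ⟨w, hw, rfl⟩ := hzK
        refine Or.inl ⟨w, lt_of_le_of_ne hw fun h ↦ hne ⟨_, hz, w, h, rfl⟩, rfl⟩
      · exact Or.inr hzK
    obtain ⟨z, -, hz1, hz2⟩ := hDc.isPreconnected _ _ hopen
      (isCompact_symm_image (isCompact_closedBall p R) hsub).isClosed.isOpen_compl hcover
      ⟨x, hxD, p, Metric.mem_ball_self hR, hxp⟩ ⟨y, hyD, hyK⟩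
    exact hz2 (image_mono Metric.ball_subset_closedBall hz1)
  exact ((ENNReal.ofReal_le_iff_le_toReal (mu_lt_top hn S x z).ne).2 (hδS z hz)).trans
    (mu_le_capacity S hD hDc hxD hzD)

end

end

end ConformalCapacity

theorem mainTheorem2 {n : ℕ} (hn : 2 ≤ n) {M : Type*} [τ : TopologicalSpace M] [T2Space M]
    [ConnectedSpace M] [ChartedSpace (ConformalCapacity.E n) M]
    [IsManifold 𝓘(ℝ, ConformalCapacity.E n) ∞ M]
    (S : ConformalCapacity.ConformalStructure n M) (hS : ConformalCapacity.IsClassII S) :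
    ∃ d : MetricSpace M,
      (∀ x y : M, ENNReal.ofReal (d.dist x y) = ConformalCapacity.mu S x y) ∧
      d.toUniformSpace.toTopologicalSpace = τ := by
  refine ⟨ConformalCapacity.muMetric hn S hS,
    fun x y ↦ ENNReal.ofReal_toReal (ConformalCapacity.mu_lt_top hn S x y).ne, ?_⟩
  refine TopologicalSpace.ext_nhds fun x ↦ ?_
  have hb := @Metric.nhds_basis_ball M
    (ConformalCapacity.muMetric hn S hS).toPseudoMetricSpace x
  refine le_antisymm (fun U hU ↦ ?_) fun U hU ↦ ?_
  · obtain ⟨δ, hδ, h⟩ := ConformalCapacity.exists_mu_lt_imp_mem hn S hS hU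
    refine hb.mem_iff.2 ⟨δ, hδ, fun y hy ↦ h y ?_⟩
    -- Membership in a ball around `x` unfolds to a bound on `mu S y x`, with the centre second.
    rw [ConformalCapacity.mu_comm]
    exact hy
  · obtain ⟨ε, hε, h⟩ := hb.mem_iff.1 hU
    have hc := (ConformalCapacity.continuous_mu_toReal hn S x).continuousAt (x := x)
    filter_upwards [hc.eventually (gt_mem_nhds
      (show (ConformalCapacity.mu S x x).toReal < ε by
        rw [ConformalCapacity.mu_self hn]; exact hε))] with y hy
    refine h ?_
    rw [ConformalCapacity.mu_comm] at hy
    exact hy
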